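/- **Theorem 4.1.** A game consists of a finite directed graph $G=(V,E)$ with $n=|V|$ vertices in which every vertex has an outgoing edge, integer edge weights $w:E\to\mathbb Z$, and a partition $V=V_{\mathrm{Min}}\sqcup V_{\mathrm{Max}}$. It is *simple* if every simple cycle (of length at least $1$) has nonzero sum. Let $N=\max_{e\in E}|w(e)|$. A strategy of a player assigns to each vertex of that player one of its outgoing edges. The energy and dual-energy of an infinite path with weights $w_0w_1\dots$ are $\sup_{k\ge 0}\sum_{i<k}w_i\in[0,\infty]$ and $\inf_{k\ge 0}\sum_{i<k}w_i\in[-\infty,0]$; the energy value of a vertex $v$ is $$\mathrm{En}^+(v)=\inf_{\sigma}\ \sup_{\pi\models\sigma}\mathrm{En}^+(w(\pi)),$$ where $\sigma$ ranges over the strategies of Min and $\pi$ over the infinite paths from $v$ consistent with $\sigma$; the dual-energy value is $$\mathrm{En}^-(v)=\sup_{\tau}\ \inf_{\pi\models\tau}\mathrm{En}^-(w(\pi)),$$ where $\tau$ ranges over the strategies of Max. (These games are determined, so exchanging the order of the players gives the same values.) Let $E^+$ be the largest finite energy value and $E^-$ minus the smallest finite dual-energy value (each is $0$ if there is no such finite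 value). For a simple game let $N^*$ (resp. $P^*$) be the set of vertices from which Min (resp. Max) can ensure that the first nonzero weight visited is negative (resp. positive). Let $$SN=\{v\in V_{\mathrm{Min}}\cap N^*: w(vv')>0\text{ for every edge } vv' \text{ with } v'\in N^*\},$$ $$SP=\{v\in V_{\mathrm{Max}}\cap P^*: w(vv')<0\text{ for every edge } vv' \text{ with } v'\in P^*\},$$ $$\delta^-=\max\Bigl(\max_{v\in SN}\min_{vv'\in E}w(vv'),\ \max\{w(e): e\in E\cap((N^*\cap V_{\mathrm{Max}})\times P^*)\}\Bigr),$$ $$\delta^+=\min\Bigl(\min_{v\in SP}\max_{vv'\in E}w(vv'),\ \min\{w(e): e\in E\cap((P^*\cap V_{\mathrm{Min}})\times N^*)\}\Bigr),$$ with $\max\varnothing=-\infty$ and $\min\varnothing=+\infty$, and let $\delta=\min(-\delta^-,\delta^+)$. If $\delta=\infty$, the GKK iteration stops. Otherwise the GKK potential $\phi$ equals $\delta$ on $P^*$ and $0$ on $N^*$, and the iteration continues with the game in which the weight of each edge $vv'$ is replaced by $w(vv')+\phi(v')-\phi(v)$. Then, started from any simple game, the GKK iteration terminates in at most $N+E^++E^-+1$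 steps (the last step, in which $\delta=\infty$ is found, being counted), and $$N+E^++E^-+1\le nN+1.$$ -/

import Mathlib

open scoped NNReal

noncomputable section

/-- A mean-payoff game on the vertex set `V`: a directed graph without sinks, an integer weight
for every edge (the values of `weight` on pairs that are not edges are never used), and the set of
vertices owned by Min; the other vertices are owned by Max. -/
structure MPGame (V : Type*) where
  graph : Digraph V
  noSink : ∀ v, ∃ v', graph.Adj v v'
  weight : V → V → ℤ
  VMin : Set V

namespace MPGame

variable {V : Type*}

/-- The vertices owned by Max. -/
def VMax (G : MPGame V) : Set V := G.VMinᶜ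

/-- The game is simple: every simple cycle `p 0 → p 1 → ⋯ → p k = p 0` (of length `k ≥ 1`, without
repetition among `p 0, …, p (k - 1)`) has nonzero sum. -/
def IsSimple (G : MPGame V) : Prop :=
  ∀ (k : ℕ) (p : ℕ → V), 1 ≤ k → (∀ i < k, G.graph.Adj (p i) (p (i + 1))) → p k = p 0 →
    Set.InjOn p (Set.Iio k) → ∑ i ∈ Finset.range k, G.weight (p i) (p (i + 1)) ≠ 0

/-- The strategies of the player who owns the vertices in `S`: each of these vertices is mapped
to the target of one of its outgoing edges. -/
def Strategy (G : MPGame V) (S : Set V) : Type _ :=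
  {σ : S → V // ∀ v : S, G.graph.Adj v (σ v)}

/-- `π` is an infinite path from `v`. -/
def IsPath (G : MPGame V) (v : V) (π : ℕ → V) : Prop :=
  π 0 = v ∧ ∀ i, G.graph.Adj (π i) (π (i + 1))

/-- The path `π` is consistent with the strategy `σ`. -/
def Consistent (G : MPGame V) {S : Set V} (σ : G.Strategy S) (π : ℕ → V) : Prop :=
  ∀ (i : ℕ) (h : π i ∈ S), π (i + 1) = σ.1 ⟨π i, h⟩

/-- The infinite paths from `v` that are consistent with `σ`. -/
def plays (G : MPGame V) {S : Set V} (σ : G.Strategy S) (v : V) : Set (ℕ → V) :=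
  {π | G.IsPath v π ∧ G.Consistent σ π}

/-- The sequence of weights on a path. -/
def weights (G : MPGame V) (π : ℕ → V) (i : ℕ) : ℤ := G.weight (π i) (π (i + 1))

/-- The energy valuation: the supremum over `k ≥ 0` of the sum of the first `k` weights. -/
def energy (u : ℕ → ℤ) : EReal := ⨆ k : ℕ, (((∑ i ∈ Finset.range k, u i : ℤ) : ℝ) : EReal)

/-- The dual-energy valuation: the infimum over `k ≥ 0` of the sum of the first `k` weights. -/
def dualEnergy (u : ℕ → ℤ) : EReal := ⨅ k : ℕ, (((∑ i ∈ Finset.range k, u i : ℤ) : ℝ) : EReal)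

/-- The energy value of a vertex (the least energy that Min can guarantee). The game is
determined, so exchanging the order of the players gives the same value. -/
def energyValue (G : MPGame V) (v : V) : EReal :=
  ⨅ σ : G.Strategy G.VMin, ⨆ π ∈ G.plays σ v, energy (G.weights π)

/-- The dual-energy value of a vertex (the largest dual energy that Max can guarantee). The game
is determined, so exchanging the order of the players gives the same value. -/
def dualEnergyValue (G : MPGame V) (v : V) : EReal :=
  ⨆ τ : G.Strategy G.VMax, ⨅ π ∈ G.plays τ v, dualEnergy (G.weights π)

/-- The modified game for the potential `φ`. -/
def reduce (G : MPGame V) (φ : V → ℤ) : MPGame V where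
  graph := G.graph
  noSink := G.noSink
  weight v v' := G.weight v v' + φ v' - φ v
  VMin := G.VMin

/-- The vertices from which Min can ensure that the first nonzero weight is visited and is
negative. -/
def NStar (G : MPGame V) : Set V :=
  {v | ∃ σ : G.Strategy G.VMin, ∀ π ∈ G.plays σ v,
    ∃ k, (∀ i < k, G.weights π i = 0) ∧ G.weights π k < 0}

/-- The vertices from which Max can ensure that the first nonzero weight is visited and is
positive. -/
def PStar (G : MPGame V) : Set V :=
  {v | ∃ τ : G.Strategy G.VMax, ∀ π ∈ G.plays τ v,
    ∃ k, (∀ i < k, G.weights π i = 0) ∧ 0 < G.weights π k}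

/-- The Min vertices in `N*` all of whose edges towards `N*` are positive. -/
def SN (G : MPGame V) : Set V :=
  {v | v ∈ G.VMin ∩ G.NStar ∧ ∀ v' ∈ G.NStar, G.graph.Adj v v' → 0 < G.weight v v'}

/-- The Max vertices in `P*` all of whose edges towards `P*` are negative. -/
def SP (G : MPGame V) : Set V :=
  {v | v ∈ G.VMax ∩ G.PStar ∧ ∀ v' ∈ G.PStar, G.graph.Adj v v' → G.weight v v' < 0}

variable [Fintype V]

open Classical in
/-- The successors of a vertex. -/
def succs (G : MPGame V) (v : V) : Finset V := Finset.univ.filter fun v' => G.graph.Adj v v'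

theorem succs_nonempty (G : MPGame V) (v : V) : (G.succs v).Nonempty := by
  obtain ⟨v', h⟩ := G.noSink v
  exact ⟨v', by simp [succs, h]⟩

/-- The least weight of an edge out of `v`. -/
def minOut (G : MPGame V) (v : V) : ℤ := (G.succs v).inf' (G.succs_nonempty v) (G.weight v)

/-- The largest weight of an edge out of `v`. -/
def maxOut (G : MPGame V) (v : V) : ℤ := (G.succs v).sup' (G.succs_nonempty v) (G.weight v)

open Classical in
/-- The edges of the graph from a vertex in `A` to a vertex in `B`. -/
def edgesBetween (G : MPGame V) (A B : Set V) : Finset (V × V) :=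
  Finset.univ.filter fun e => G.graph.Adj e.1 e.2 ∧ e.1 ∈ A ∧ e.2 ∈ B

/-- The largest weight of an edge from a Max vertex of `N*` to `P*`
(`⊥ = -∞` if there is none). -/
def deltaMaxNeg (G : MPGame V) : WithBot ℤ :=
  (G.edgesBetween (G.NStar ∩ G.VMax) G.PStar).sup fun e => (G.weight e.1 e.2 : WithBot ℤ)

open Classical in
/-- The maximum over `SN` of the least outgoing weight (`⊥ = -∞` if `SN` is empty). -/
def deltaMinNeg (G : MPGame V) : WithBot ℤ :=
  (Finset.univ.filter fun v => v ∈ G.SN).sup fun v => (G.minOut v : WithBot ℤ)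

def deltaNeg (G : MPGame V) : WithBot ℤ := max G.deltaMinNeg G.deltaMaxNeg

/-- The least weight of an edge from a Min vertex of `P*` to `N*`
(`⊤ = +∞` if there is none). -/
def deltaMinPos (G : MPGame V) : WithTop ℤ :=
  (G.edgesBetween (G.PStar ∩ G.VMin) G.NStar).inf fun e => (G.weight e.1 e.2 : WithTop ℤ)

open Classical in
/-- The minimum over `SP` of the largest outgoing weight (`⊤ = +∞` if `SP` is empty). -/
def deltaMaxPos (G : MPGame V) : WithTop ℤ :=
  (Finset.univ.filter fun v => v ∈ G.SP).inf fun v => (G.maxOut v : WithTop ℤ)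

def deltaPos (G : MPGame V) : WithTop ℤ := min G.deltaMinPos G.deltaMaxPos

/-- Negation from `ℤ ∪ {-∞}` to `ℤ ∪ {+∞}`. -/
def negBot : WithBot ℤ → WithTop ℤ :=
  WithBot.recBotCoe ⊤ fun a => ((-a : ℤ) : WithTop ℤ)

/-- `δ = min(-δ⁻, δ⁺)`; the iteration stops when it is `⊤ = +∞`. -/
def delta (G : MPGame V) : WithTop ℤ := min (negBot G.deltaNeg) G.deltaPos

open Classical in
/-- The GKK potential: `δ` on `P*` and `0` on `N*`. It is only meaningful when `δ < ∞`; for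
`δ = ∞` it is set to `0`. -/
def gkkPotential (G : MPGame V) (v : V) : ℤ := if v ∈ G.PStar then G.delta.untopD 0 else 0

/-- The game `G ^ j` encountered in the `j`-th iteration (counted from `0`), meaningful as long as
`δ < ∞` in all the previous games. -/
def gkkGame (G : MPGame V) : ℕ → MPGame V
  | 0 => G
  | j + 1 => (gkkGame G j).reduce (gkkGame G j).gkkPotential

/-- The iteration started in `G` stops in its `s`-th step: the `s`-th game (the first one is `G`
itself) is the first one with `δ = ∞`. -/
def StopsAfter (G : MPGame V) (s : ℕ) : Prop :=
  ∃ l : ℕ, s = l + 1 ∧ (∀ j < l, (G.gkkGame j).delta ≠ ⊤) ∧ (G.gkkGame l).delta = ⊤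

/-- The largest absolute value of the weight of an edge. -/
def maxWeight (G : MPGame V) : ℕ :=
  (G.edgesBetween Set.univ Set.univ).sup fun e => (G.weight e.1 e.2).natAbs

open Classical in
/-- The largest finite energy value (energy values are nonnegative; it is `0` if there is no
finite one). -/
def maxEnergy (G : MPGame V) : ℝ≥0 :=
  (Finset.univ.filter fun v => G.energyValue v ≠ ⊤).sup fun v =>
    (G.energyValue v).toENNReal.toNNReal

open Classical in
/-- Minus the least finite dual-energy value (dual-energy values are nonpositive; it is `0` if
there is no finite one). -/
def maxDualEnergy (G : MPGame V) : ℝ≥0 :=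
  (Finset.univ.filter fun v => G.dualEnergyValue v ≠ ⊥).sup fun v =>
    (-G.dualEnergyValue v).toENNReal.toNNReal

end MPGame

end

/-! Let `Φ j` be the sum of the first `j` potentials and `D j` the sum of the first `j` values of
`δ`. Each finite `δ` is an integer at least 1, so the number of potential updates is at most `D`,
and it suffices to bound `D`. Exchanging the players turns `Φ j` into `D j - Φ j`, so each claim is
needed for one player only.

The central invariant (`minPre_nonpos`) is that once a vertex has been in `N*`, Min can always avoid
positive edges there; dually for `P*` and Max. A vertex of `N*` that was once in `P*` therefore has
a zero edge into `N*`. As a simple game has no zero cycle, following such edges leaves every set of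
such vertices. Hence any set separating the vertices that were always in `N*` (where `Φ = 0`) from
those always in `P*` (where `Φ = D`) is crossed by an edge of weight zero in the next game
(`exists_crossing_edge`). The potentials at the ends of that edge differ by at most `N`.

For threshold sets of `Φ` this says that the potentials from 0 to `D` have no gap larger than `N`,
so `D ≤ nN` and the iteration terminates. In the last game `Φ` is the energy value on `N*` and `Φ -
D` the dual-energy value on `P*`; the other energy and dual-energy values are infinite. If the final
`N*` is crossed by an edge `xy` as above, with `x` in `N*` and `y` in `P*` in either orientation,
then `D = Φ x + (Φ y - Φ x) + (D - Φ y) ≤ E⁺ + N + E⁻`. The gap argument inside the final `N*` and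
`P*` gives `E⁺ + N ≤ |N*| N` and `E⁻ + N ≤ |P*| N` when these sets are nonempty, which yields the
second inequality. -/

open scoped NNReal

noncomputable section

namespace MPGame

/-! ### Duality, simple games, and the partition into `N*` and `P*` -/

section

variable {V : Type*}

/-- The game in which the two players exchange their roles. -/
def dual (G : MPGame V) : MPGame V where
  graph := G.graph
  noSink := G.noSink
  weight v v' := -G.weight v v'
  VMin := G.VMinᶜ

theorem dual_weight (G : MPGame V) (v v' : V) : G.dual.weight v v' = -G.weight v v' := rfl

theorem dual_VMin (G : MPGame V) : G.dual.VMin = G.VMax := rfl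

theorem dual_VMax (G : MPGame V) : G.dual.VMax = G.VMin := compl_compl _

theorem dual_dual (G : MPGame V) : G.dual.dual = G := by
  cases G
  simp [dual]

theorem dual_NStar (G : MPGame V) : G.dual.NStar = G.PStar := by
  ext v
  change (∃ σ : G.Strategy G.VMax, ∀ π ∈ G.plays σ v,
    ∃ k, (∀ i < k, -G.weights π i = 0) ∧ -G.weights π k < 0) ↔ _
  simp [PStar]

theorem dual_PStar (G : MPGame V) : G.dual.PStar = G.NStar := by
  rw [← dual_NStar, dual_dual]

theorem ereal_neg_iInf {ι : Sort*} (f : ι → EReal) : -(⨅ i, f i) = ⨆ i, -f i :=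
  EReal.negOrderIso.map_iInf f

theorem ereal_neg_iSup {ι : Sort*} (f : ι → EReal) : -(⨆ i, f i) = ⨅ i, -f i :=
  EReal.negOrderIso.map_iSup f

theorem dual_SN (G : MPGame V) : G.dual.SN = G.SP := by
  ext v
  simp only [SN, SP, dual_NStar, dual_VMin]
  simp [dual]

theorem energy_neg (u : ℕ → ℤ) : energy (fun i => -u i) = -dualEnergy u := by
  simp only [energy, dualEnergy, Finset.sum_neg_distrib, Int.cast_neg, EReal.coe_neg,
    ereal_neg_iInf]

theorem dual_energyValue (G : MPGame V) (v : V) :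
    G.dual.energyValue v = -G.dualEnergyValue v := by
  change (⨅ σ : G.Strategy G.VMax, ⨆ π ∈ G.plays σ v, energy (fun i => -G.weights π i)) = _
  simp only [energy_neg, dualEnergyValue, ereal_neg_iSup, ereal_neg_iInf]

/-- The constant `c` cancels on every edge. It is kept so that the dual potential can be normalized
to be unchanged on the `N*` of the dual game. -/
theorem reduce_dual (G : MPGame V) (φ : V → ℤ) (c : ℤ) :
    G.dual.reduce (fun v => c - φ v) = (G.reduce φ).dual := by
  simp only [dual, reduce, mk.injEq, true_and, and_true]
  funext v v'
  ring

theorem reduce_reduce (G : MPGame V) (φ ψ : V → ℤ) :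
    (G.reduce φ).reduce ψ = G.reduce (fun v => φ v + ψ v) := by
  simp only [reduce, mk.injEq, true_and, and_true]
  funext v v'
  ring

theorem reduce_zero (G : MPGame V) : G.reduce (fun _ => 0) = G := by
  simp [reduce]

theorem IsSimple.dual {G : MPGame V} (hG : G.IsSimple) : G.dual.IsSimple := by
  intro k p hk hp hc hi h
  refine hG k p hk hp hc hi ?_
  simpa [MPGame.dual] using h

theorem IsSimple.reduce {G : MPGame V} (hG : G.IsSimple) (φ : V → ℤ) :
    (G.reduce φ).IsSimple := by
  intro k p hk hp hc hi h
  refine hG k p hk hp hc hi ?_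
  have h2 := Finset.sum_range_sub (fun i => φ (p i)) k
  simp only [hc, sub_self] at h2
  rw [← h, ← add_zero (∑ i ∈ Finset.range k, G.weight (p i) (p (i + 1))), ← h2,
    ← Finset.sum_add_distrib]
  refine Finset.sum_congr rfl fun i _ => ?_
  simp only [MPGame.reduce]
  ring

/-- In a simple game on finitely many vertices there is no infinite path of weight zero. -/
theorem IsSimple.wellFounded [Finite V] {G : MPGame V} (hG : G.IsSimple) :
    WellFounded fun v' v => G.graph.Adj v v' ∧ G.weight v v' = 0 := by
  rw [wellFounded_iff_isEmpty_descending_chain]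
  refine ⟨fun ⟨p, hp⟩ => ?_⟩
  have hex : ∃ j, ∃ i < j, p i = p j := by
    obtain ⟨a, b, hab, h⟩ := Finite.exists_ne_map_eq_of_infinite p
    rcases lt_or_gt_of_ne hab with h1 | h1
    · exact ⟨b, a, h1, h⟩
    · exact ⟨a, b, h1, h.symm⟩
  classical
  -- The first index `j` that repeats an earlier vertex closes a cycle without other repetitions, as
  -- simplicity requires.
  obtain ⟨i, hij, he⟩ := Nat.find_spec hex
  have hmin := fun m => @Nat.find_min _ _ hex m
  set j := Nat.find hex
  refine hG (j - i) (fun n => p (i + n)) (by omega) (fun n _ => (hp _).1) ?_ ?_ ?_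
  · simp only [add_zero]
    rw [he]
    congr 1
    omega
  · intro a ha b hb hab
    simp only [Set.mem_Iio] at ha hb
    by_contra hne
    rcases lt_or_gt_of_ne hne with h1 | h1
    · exact hmin (i + b) (by omega) ⟨i + a, by omega, hab⟩
    · exact hmin (i + a) (by omega) ⟨i + b, by omega, hab.symm⟩
  · exact Finset.sum_eq_zero fun n _ => (hp _).2

/-- In a simple game, a set in which every vertex has an edge of weight zero inside the set is
empty. -/
theorem IsSimple.eq_empty [Finite V] {G : MPGame V} (hG : G.IsSimple) (X : Set V)
    (hX : ∀ v ∈ X, ∃ v' ∈ X, G.graph.Adj v v' ∧ G.weight v v' = 0) : X = ∅ := by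
  ext v
  simp only [Set.mem_empty_iff_false, iff_false]
  induction v using hG.wellFounded.induction with
  | _ v ih =>
    intro hv
    obtain ⟨v', h', h⟩ := hX v hv
    exact ih v' h h'

/-- Min can ensure that the next edge from `v` satisfies `Q`. -/
def minPre (G : MPGame V) (Q : V → V → Prop) (v : V) : Prop :=
  (v ∈ G.VMin → ∃ v', G.graph.Adj v v' ∧ Q v v') ∧
    (v ∉ G.VMin → ∀ v', G.graph.Adj v v' → Q v v')

theorem minPre.imp {G : MPGame V} {Q R : V → V → Prop} {v : V} (h : G.minPre Q v)
    (hQR : ∀ v', G.graph.Adj v v' → Q v v' → R v v') : G.minPre R v :=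
  ⟨fun hv => (h.1 hv).imp fun v' h' => ⟨h'.1, hQR v' h'.1 h'.2⟩,
    fun hv v' h' => hQR v' h' (h.2 hv v' h')⟩

theorem dual_minPre_not {G : MPGame V} {Q : V → V → Prop} {v : V} (h : ¬ G.minPre Q v) :
    G.dual.minPre (fun v v' => ¬ Q v v') v := by
  constructor
  · intro hv
    by_contra h'
    push Not at h'
    exact h ⟨fun h2 => absurd h2 hv, fun _ => h'⟩
  · intro hv v' hvv' hQ
    have hv : v ∈ G.VMin := by simpa [dual] using hv
    exact h ⟨fun _ => ⟨v', hvv', hQ⟩, fun h2 => absurd hv h2⟩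

/-- The owner of `v` picks an edge with one property; the other property holds on all edges. -/
theorem minPre.exists_and {G : MPGame V} {Q R : V → V → Prop} {v : V} (h : G.minPre Q v)
    (h' : G.dual.minPre R v) : ∃ v', G.graph.Adj v v' ∧ Q v v' ∧ R v v' := by
  by_cases hv : v ∈ G.VMin
  · obtain ⟨v', h1, h2⟩ := h.1 hv
    exact ⟨v', h1, h2, h'.2 (by simpa [dual] using hv) v' h1⟩
  · obtain ⟨v', h1, h2⟩ := h'.1 hv
    exact ⟨v', h1, h.2 hv v' h1, h2⟩

/-- A strategy of Min that chooses an edge satisfying `Q` wherever this is possible. -/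
theorem exists_strategy_minPre (G : MPGame V) (Q : V → V → Prop) :
    ∃ σ : G.Strategy G.VMin, ∀ v, G.minPre Q v → ∀ v', G.graph.Adj v v' →
      (∀ h : v ∈ G.VMin, v' = σ.1 ⟨v, h⟩) → Q v v' := by
  have key : ∀ v : G.VMin, ∃ v', G.graph.Adj v v' ∧ (G.minPre Q v → Q v v') := by
    intro v
    by_cases h : G.minPre Q v
    · obtain ⟨v', h1, h2⟩ := h.1 v.2
      exact ⟨v', h1, fun _ => h2⟩
    · obtain ⟨v', h1⟩ := G.noSink v
      exact ⟨v', h1, fun h' => absurd h' h⟩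
  choose s hs using key
  refine ⟨⟨s, fun v => (hs v).1⟩, fun v hv v' hvv' hσ => ?_⟩
  by_cases h : v ∈ G.VMin
  · rw [hσ h]
    exact (hs ⟨v, h⟩).2 hv
  · exact hv.2 h v' hvv'

/-- Min plays the local choices; a play cannot follow zero edges forever, so a negative weight is
reached after finitely many zeros. -/
theorem subset_NStar [Finite V] {G : MPGame V} (hG : G.IsSimple) (X : Set V)
    (hX : ∀ v ∈ X, G.minPre
      (fun v v' => G.weight v v' < 0 ∨ (G.weight v v' = 0 ∧ v' ∈ X)) v) :
    X ⊆ G.NStar := by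
  obtain ⟨σ, hσ⟩ := G.exists_strategy_minPre
    (fun v v' => G.weight v v' < 0 ∨ (G.weight v v' = 0 ∧ v' ∈ X))
  intro v hv
  refine ⟨σ, ?_⟩
  induction v using hG.wellFounded.induction with
  | _ v ih =>
    rintro π ⟨⟨h0, hp⟩, hc⟩
    subst h0
    rcases hσ _ (hX _ hv) (π 1) (hp 0) (fun h => hc 0 h) with h | ⟨h, h'⟩
    · exact ⟨0, by simp, h⟩
    · obtain ⟨k, hk, hk'⟩ := ih (π 1) ⟨hp 0, h⟩ h' (fun i => π (i + 1))
        ⟨⟨rfl, fun i => hp (i + 1)⟩, fun i h => hc (i + 1) h⟩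
      refine ⟨k + 1, fun i hi => ?_, hk'⟩
      cases i with
      | zero => exact h
      | succ i => exact hk i (by omega)

theorem subset_PStar [Finite V] {G : MPGame V} (hG : G.IsSimple) (X : Set V)
    (hX : ∀ v ∈ X, G.dual.minPre
      (fun v v' => 0 < G.weight v v' ∨ (G.weight v v' = 0 ∧ v' ∈ X)) v) :
    X ⊆ G.PStar := by
  rw [← dual_NStar]
  refine subset_NStar hG.dual X fun v hv => (hX v hv).imp fun v' _ h => ?_
  simpa [dual] using h

theorem exists_play (G : MPGame V) (σ : G.Strategy G.VMin) (τ : G.Strategy G.VMax) (v : V) :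
    ∃ π, π ∈ G.plays σ v ∧ π ∈ G.plays τ v := by
  classical
  let next : V → V := fun u => if h : u ∈ G.VMin then σ.1 ⟨u, h⟩ else τ.1 ⟨u, h⟩
  have h1 : ∀ u (h : u ∈ G.VMin), next u = σ.1 ⟨u, h⟩ := fun u h => dif_pos h
  have h2 : ∀ u (h : u ∈ G.VMax), next u = τ.1 ⟨u, h⟩ := fun u h => dif_neg h
  have hadj : ∀ u, G.graph.Adj u (next u) := by
    intro u
    by_cases h : u ∈ G.VMin
    · rw [h1 u h]; exact σ.2 ⟨u, h⟩
    · rw [h2 u h]; exact τ.2 ⟨u, h⟩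
  have hs : ∀ i, next^[i + 1] v = next (next^[i] v) :=
    fun i => Function.iterate_succ_apply' next i v
  have hpath : G.IsPath v (fun i => next^[i] v) :=
    ⟨rfl, fun i => by simpa only [hs] using hadj _⟩
  exact ⟨fun i => next^[i] v, ⟨hpath, fun i h => by simpa only [hs] using h1 _ h⟩,
    ⟨hpath, fun i h => by simpa only [hs] using h2 _ h⟩⟩

theorem NStar_disjoint_PStar (G : MPGame V) {v : V} (hN : v ∈ G.NStar) : v ∉ G.PStar := by
  rintro ⟨τ, hτ⟩
  obtain ⟨σ, hσ⟩ := hN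
  obtain ⟨π, h1, h2⟩ := G.exists_play σ τ v
  obtain ⟨k, hk, hk'⟩ := hσ π h1
  obtain ⟨m, hm, hm'⟩ := hτ π h2
  rcases lt_trichotomy k m with h | h | h
  · have := hm k h; omega
  · subst h; omega
  · have := hk m h; omega

/-- A fixed point exists by Knaster–Tarski. Which one does not matter: simplicity later forces it to
be `N*`. -/
theorem exists_partition (G : MPGame V) : ∃ X : Set V, ∀ v, v ∈ X ↔ G.minPre
    (fun v v' => G.weight v v' < 0 ∨ (G.weight v v' = 0 ∧ v' ∈ X)) v := by
  let P : Set V → V → V → Prop :=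
    fun X v v' => G.weight v v' < 0 ∨ (G.weight v v' = 0 ∧ v' ∈ X)
  have hP : ∀ X Y : Set V, X ⊆ Y → ∀ v, G.minPre (P X) v → G.minPre (P Y) v :=
    fun X Y hXY v hv => hv.imp fun v' _ h => h.imp id fun h => ⟨h.1, hXY h.2⟩
  let F : Set V →o Set V := ⟨fun X => {v | G.minPre (P X) v}, hP⟩
  refine ⟨F.lfp, fun v => ?_⟩
  conv_lhs => rw [← F.map_lfp]
  rfl

/-- For a fixed point `X`, Min wins on `X` and Max wins on its complement. Since `N*` and `P*` are
disjoint, both inclusions are equalities. -/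
theorem IsSimple.NStar_spec [Finite V] {G : MPGame V} (hG : G.IsSimple) :
    G.PStar = G.NStarᶜ ∧ ∀ v, v ∈ G.NStar ↔ G.minPre
      (fun v v' => G.weight v v' < 0 ∨ (G.weight v v' = 0 ∧ v' ∈ G.NStar)) v := by
  obtain ⟨X, hX⟩ := G.exists_partition
  have h1 : X ⊆ G.NStar := subset_NStar hG X fun v hv => (hX v).1 hv
  have h2 : Xᶜ ⊆ G.PStar := by
    refine subset_PStar hG _ fun v hv => ?_
    refine (dual_minPre_not (fun h => hv ((hX v).2 h))).imp fun v' _ h => ?_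
    push Not at h
    rcases h.1.lt_or_eq with h' | h'
    · exact Or.inl h'
    · exact Or.inr ⟨h'.symm, h.2 h'.symm⟩
  have h3 : G.NStar = X := by
    refine Set.Subset.antisymm (fun v hv => ?_) h1
    by_contra h
    exact G.NStar_disjoint_PStar hv (h2 h)
  rw [h3]
  refine ⟨Set.Subset.antisymm (fun v hv h => ?_) h2, hX⟩
  exact G.NStar_disjoint_PStar (h1 h) hv

theorem IsSimple.PStar_eq [Finite V] {G : MPGame V} (hG : G.IsSimple) :
    G.PStar = G.NStarᶜ := hG.NStar_spec.1

theorem IsSimple.minPre_of_mem_NStar [Finite V] {G : MPGame V} (hG : G.IsSimple) {v : V}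
    (hv : v ∈ G.NStar) : G.minPre
      (fun v v' => G.weight v v' < 0 ∨ (G.weight v v' = 0 ∧ v' ∈ G.NStar)) v :=
  (hG.NStar_spec.2 v).1 hv

end

/-! ### The properties of `δ` -/

section

variable {V : Type*}

theorem negBot_le {a : ℤ} {x : WithBot ℤ} (h : (a : WithBot ℤ) ≤ x) :
    negBot x ≤ ((-a : ℤ) : WithTop ℤ) := by
  induction x with
  | bot => simp at h
  | coe b =>
    have h : a ≤ b := by exact_mod_cast h
    change ((-b : ℤ) : WithTop ℤ) ≤ _
    exact_mod_cast neg_le_neg h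

theorem one_le_negBot {x : WithBot ℤ} (h : x ≤ ((-1 : ℤ) : WithBot ℤ)) : 1 ≤ negBot x := by
  induction x with
  | bot => exact le_top
  | coe b =>
    have h : b ≤ -1 := by exact_mod_cast h
    change ((1 : ℤ) : WithTop ℤ) ≤ ((-b : ℤ) : WithTop ℤ)
    exact_mod_cast (by omega : 1 ≤ -b)

theorem eq_of_negBot_eq {x : WithBot ℤ} {e : ℤ} (h : negBot x = e) :
    x = ((-e : ℤ) : WithBot ℤ) := by
  induction x with
  | bot => exact absurd h (WithTop.top_ne_coe)
  | coe b =>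
    have h : ((-b : ℤ) : WithTop ℤ) = e := h
    have h : -b = e := by exact_mod_cast h
    rw [← h, neg_neg]

theorem negBot_max (x y : WithBot ℤ) : negBot (max x y) = min (negBot x) (negBot y) := by
  induction x with
  | bot => simp [negBot]
  | coe a =>
    induction y with
    | bot => simp [negBot]
    | coe b =>
      change negBot (max (a : WithBot ℤ) b) = min ((-a : ℤ) : WithTop ℤ) ((-b : ℤ) : WithTop ℤ)
      rw [← WithBot.coe_max, ← WithTop.coe_min, min_neg_neg]
      rfl

theorem negBot_sup {ι : Type*} (s : Finset ι) (f : ι → ℤ) :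
    negBot (s.sup fun i => (f i : WithBot ℤ)) = s.inf fun i => ((-f i : ℤ) : WithTop ℤ) := by
  classical
  induction s using Finset.induction_on with
  | empty => rfl
  | insert a s _ ih =>
    rw [Finset.sup_insert, Finset.inf_insert, ← ih]
    exact negBot_max _ _

variable [Fintype V]

theorem mem_succs {G : MPGame V} {v v' : V} : v' ∈ G.succs v ↔ G.graph.Adj v v' := by
  simp [succs]

theorem mem_edgesBetween {G : MPGame V} {A B : Set V} {v v' : V} :
    (v, v') ∈ G.edgesBetween A B ↔ G.graph.Adj v v' ∧ v ∈ A ∧ v' ∈ B := by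
  simp [edgesBetween]

theorem dual_minOut (G : MPGame V) (v : V) : G.dual.minOut v = -G.maxOut v := by
  apply le_antisymm
  · obtain ⟨v', h1, h2⟩ := Finset.exists_mem_eq_sup' (G.succs_nonempty v) (G.weight v)
    rw [maxOut, h2]
    exact Finset.inf'_le (G.dual.weight v) h1
  · refine Finset.le_inf' _ _ fun v' hv' => ?_
    exact neg_le_neg (Finset.le_sup' (G.weight v) hv')

theorem negBot_dual_deltaNeg (G : MPGame V) : negBot G.dual.deltaNeg = G.deltaPos := by
  rw [deltaNeg, negBot_max, deltaMinNeg, deltaMaxNeg, negBot_sup, negBot_sup, min_comm,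
    dual_NStar, dual_PStar, dual_VMax, dual_SN, deltaPos, deltaMinPos, deltaMaxPos]
  simp only [dual_minOut, dual_weight, neg_neg]
  congr! 2

theorem delta_eq (G : MPGame V) :
    G.delta = min (negBot G.deltaNeg) (negBot G.dual.deltaNeg) := by
  rw [negBot_dual_deltaNeg, delta]

theorem minOut_le {G : MPGame V} {v v' : V} (h : G.graph.Adj v v') :
    G.minOut v ≤ G.weight v v' := Finset.inf'_le _ (mem_succs.2 h)

theorem exists_eq_minOut (G : MPGame V) (v : V) :
    ∃ v', G.graph.Adj v v' ∧ G.weight v v' = G.minOut v := by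
  obtain ⟨v', h1, h2⟩ := Finset.exists_mem_eq_inf' (G.succs_nonempty v) (G.weight v)
  exact ⟨v', mem_succs.1 h1, h2.symm⟩

/-- A vertex of `SN` has a negative edge. -/
theorem IsSimple.minOut_neg {G : MPGame V} (hG : G.IsSimple) {v : V} (hv : v ∈ G.SN) :
    G.minOut v < 0 := by
  obtain ⟨v', h1, h2⟩ := (hG.minPre_of_mem_NStar hv.1.2).1 hv.1.1
  rcases h2 with h2 | h2
  · exact (minOut_le h1).trans_lt h2
  · exact absurd (hv.2 v' h2.2 h1) (by omega)

theorem IsSimple.mem_or {G : MPGame V} (hG : G.IsSimple) (v : V) :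
    v ∈ G.NStar ∨ v ∈ G.PStar := by
  rw [hG.PStar_eq]
  exact em _

theorem IsSimple.one_le_negBot_deltaNeg {G : MPGame V} (hG : G.IsSimple) :
    1 ≤ negBot G.deltaNeg := by
  refine one_le_negBot (max_le (Finset.sup_le fun v hv => ?_) (Finset.sup_le fun e he => ?_))
  · have := hG.minOut_neg (v := v) (by simpa using hv)
    exact_mod_cast (by omega : G.minOut v ≤ -1)
  · obtain ⟨h1, ⟨h2, h3⟩, h4⟩ := mem_edgesBetween.1 he
    have := (hG.minPre_of_mem_NStar h2).2 h3 _ h1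
    have h5 : e.2 ∉ G.NStar := fun h => G.NStar_disjoint_PStar h h4
    have : G.weight e.1 e.2 < 0 := by tauto
    exact_mod_cast (by omega : G.weight e.1 e.2 ≤ -1)

/-- Outside `SN`, a Min vertex has a nonpositive edge inside `N*`. In `SN` its lightest edge is
negative, hence ends in `P*`, and its weight enters the maximum `δ⁻`. All edges from a Max vertex to
`P*` enter that maximum too. -/
theorem IsSimple.minPre_negBot_deltaNeg {G : MPGame V} (hG : G.IsSimple) {v : V}
    (hv : v ∈ G.NStar) : G.minPre (fun v v' => (G.weight v v' ≤ 0 ∧ v' ∈ G.NStar) ∨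
      (negBot G.deltaNeg ≤ ((-G.weight v v' : ℤ) : WithTop ℤ) ∧ v' ∈ G.PStar)) v := by
  constructor
  · intro hm
    by_cases hS : v ∈ G.SN
    · obtain ⟨v', h1, h2⟩ := G.exists_eq_minOut v
      have h3 := hG.minOut_neg hS
      refine ⟨v', h1, Or.inr ⟨?_, ?_⟩⟩
      · rw [h2]
        refine negBot_le (le_trans ?_ (le_max_left _ _))
        exact Finset.le_sup (f := fun v => (G.minOut v : WithBot ℤ)) (by simpa using hS)
      · refine (hG.mem_or v').resolve_left fun h => ?_
        have := hS.2 v' h h1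
        omega
    · have : ¬ ∀ v' ∈ G.NStar, G.graph.Adj v v' → 0 < G.weight v v' := fun h => hS ⟨⟨hm, hv⟩, h⟩
      push Not at this
      obtain ⟨v', h1, h2, h3⟩ := this
      exact ⟨v', h2, Or.inl ⟨h3, h1⟩⟩
  · intro hm v' hvv'
    rcases hG.mem_or v' with h | h
    · left
      have := (hG.minPre_of_mem_NStar hv).2 hm v' hvv'
      exact ⟨by omega, h⟩
    · right
      refine ⟨negBot_le (le_trans ?_ (le_max_right _ _)), h⟩
      exact Finset.le_sup (f := fun e : V × V => (G.weight e.1 e.2 : WithBot ℤ))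
        ((mem_edgesBetween (A := G.NStar ∩ G.VMax) (v := v) (v' := v')).2 ⟨hvv', ⟨hv, hm⟩, h⟩)

theorem IsSimple.exists_edge_of_negBot_deltaNeg {G : MPGame V} (hG : G.IsSimple) {e : ℤ}
    (he : negBot G.deltaNeg = e) :
    ∃ v v', G.graph.Adj v v' ∧ v ∈ G.NStar ∧ v' ∈ G.PStar ∧ G.weight v v' = -e := by
  have he := eq_of_negBot_eq he
  rw [deltaNeg] at he
  rcases max_choice G.deltaMinNeg G.deltaMaxNeg with h | h <;> rw [h] at he
  · classical
    have hne : (Finset.univ.filter fun v => v ∈ G.SN).Nonempty := by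
      rw [Finset.nonempty_iff_ne_empty]
      intro h0
      rw [deltaMinNeg, h0] at he
      exact WithBot.bot_ne_coe he
    obtain ⟨v, h1, h2⟩ := Finset.exists_mem_eq_sup _ hne fun v => (G.minOut v : WithBot ℤ)
    rw [deltaMinNeg, h2] at he
    have hS : v ∈ G.SN := by simpa using h1
    obtain ⟨v', h3, h4⟩ := G.exists_eq_minOut v
    refine ⟨v, v', h3, hS.1.2, (hG.mem_or v').resolve_left fun h => ?_, ?_⟩
    · have := hS.2 v' h h3
      have := hG.minOut_neg hS
      omega
    · rw [h4]
      exact_mod_cast he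
  · have hne : (G.edgesBetween (G.NStar ∩ G.VMax) G.PStar).Nonempty := by
      rw [Finset.nonempty_iff_ne_empty]
      intro h0
      rw [deltaMaxNeg, h0] at he
      exact WithBot.bot_ne_coe he
    obtain ⟨⟨v, v'⟩, h1, h2⟩ := Finset.exists_mem_eq_sup _ hne
      fun e => (G.weight e.1 e.2 : WithBot ℤ)
    rw [deltaMaxNeg, h2] at he
    obtain ⟨h3, h4, h5⟩ := mem_edgesBetween.1 h1
    exact ⟨v, v', h3, h4.1, h5, by exact_mod_cast he⟩

/-- The properties of `δ` on which the analysis relies. -/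
structure IsDelta (G : MPGame V) (d : WithTop ℤ) : Prop where
  one_le : 1 ≤ d
  neg : ∀ v ∈ G.NStar, G.minPre (fun v v' => (G.weight v v' ≤ 0 ∧ v' ∈ G.NStar) ∨
    (d ≤ ((-G.weight v v' : ℤ) : WithTop ℤ) ∧ v' ∈ G.PStar)) v
  pos : ∀ v ∈ G.PStar, G.dual.minPre (fun v v' => (0 ≤ G.weight v v' ∧ v' ∈ G.PStar) ∨
    (d ≤ (G.weight v v' : WithTop ℤ) ∧ v' ∈ G.NStar)) v
  attained : ∀ e : ℤ, d = e → ∃ v v', G.graph.Adj v v' ∧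
    (v ∈ G.NStar ∧ v' ∈ G.PStar ∧ G.weight v v' = -e ∨
      v ∈ G.PStar ∧ v' ∈ G.NStar ∧ G.weight v v' = e)

theorem IsSimple.isDelta {G : MPGame V} (hG : G.IsSimple) : G.IsDelta G.delta where
  one_le := by
    rw [delta_eq]
    exact le_min hG.one_le_negBot_deltaNeg hG.dual.one_le_negBot_deltaNeg
  neg v hv := by
    refine (hG.minPre_negBot_deltaNeg hv).imp fun v' _ h => h.imp id fun h => ⟨?_, h.2⟩
    rw [delta_eq]
    exact (min_le_left _ _).trans h.1
  pos v hv := by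
    rw [← dual_NStar] at hv
    refine (hG.dual.minPre_negBot_deltaNeg hv).imp fun v' _ h => h.imp ?_ ?_
    · simp [dual_NStar, dual_weight]
    · rw [delta_eq, dual_PStar]
      refine fun h => ⟨(min_le_right _ _).trans (h.1.trans_eq ?_), h.2⟩
      simp [dual_weight]
  attained e he := by
    rw [delta_eq] at he
    rcases min_choice (negBot G.deltaNeg) (negBot G.dual.deltaNeg) with h | h <;> rw [h] at he
    · obtain ⟨v, v', h1, h2, h3, h4⟩ := hG.exists_edge_of_negBot_deltaNeg he
      exact ⟨v, v', h1, Or.inl ⟨h2, h3, h4⟩⟩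
    · obtain ⟨v, v', h1, h2, h3, h4⟩ := hG.dual.exists_edge_of_negBot_deltaNeg he
      rw [dual_NStar] at h2
      rw [dual_PStar] at h3
      exact ⟨v, v', h1, Or.inr ⟨h2, h3, neg_injective h4⟩⟩

omit [Fintype V] in
theorem IsDelta.dual {G : MPGame V} {d : WithTop ℤ} (h : G.IsDelta d) : G.dual.IsDelta d where
  one_le := h.one_le
  neg v hv := by
    rw [dual_NStar] at hv
    refine (h.pos v hv).imp fun v' _ h => ?_
    simpa [dual_NStar, dual_PStar, dual_weight] using h
  pos v hv := by
    rw [dual_PStar] at hv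
    rw [dual_dual]
    refine (h.neg v hv).imp fun v' _ h => ?_
    simpa [dual_NStar, dual_PStar, dual_weight] using h
  attained e he := by
    obtain ⟨v, v', h1, h2⟩ := h.attained e he
    rw [dual_NStar, dual_PStar]
    refine ⟨v, v', h1, h2.symm.imp ?_ ?_⟩
    · exact fun h => ⟨h.1, h.2.1, congrArg Neg.neg h.2.2⟩
    · exact fun h => ⟨h.1, h.2.1, by simp [dual_weight, h.2.2]⟩

end

/-! ### Runs of the iteration and zero edges -/

section

variable {V : Type*}

theorem reduce_weight (G : MPGame V) (φ : V → ℤ) (v v' : V) :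
    (G.reduce φ).weight v v' = G.weight v v' + φ v' - φ v := rfl

theorem minPre_reduce {G : MPGame V} {φ : V → ℤ} {Q : V → V → Prop} {v : V} :
    (G.reduce φ).minPre Q v ↔ G.minPre Q v := Iff.rfl

/-- `l` steps of the iteration: `d j` is the value of `δ` in the `j`-th step and `Φ j` the sum of
the potentials of the previous steps. -/
structure IsRun (G : MPGame V) (Φ : ℕ → V → ℤ) (d : ℕ → ℤ) (l : ℕ) : Prop where
  zero : ∀ v, Φ 0 v = 0
  isDelta : ∀ j < l, (G.reduce (Φ j)).IsDelta (d j : WithTop ℤ)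
  succ_of_mem_PStar : ∀ j < l, ∀ v ∈ (G.reduce (Φ j)).PStar, Φ (j + 1) v = Φ j v + d j
  succ_of_mem_NStar : ∀ j < l, ∀ v ∈ (G.reduce (Φ j)).NStar, Φ (j + 1) v = Φ j v

namespace IsRun

variable {G : MPGame V} {Φ : ℕ → V → ℤ} {d : ℕ → ℤ} {l : ℕ}

theorem reduce_dual (G : MPGame V) (Φ : ℕ → V → ℤ) (d : ℕ → ℤ) (j : ℕ) :
    G.dual.reduce (fun v => ∑ i ∈ Finset.range j, d i - Φ j v) = (G.reduce (Φ j)).dual :=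
  MPGame.reduce_dual G (Φ j) _

theorem dual (h : G.IsRun Φ d l) :
    G.dual.IsRun (fun j v => ∑ i ∈ Finset.range j, d i - Φ j v) d l where
  zero v := by simp [h.zero]
  isDelta j hj := by
    rw [reduce_dual]
    exact (h.isDelta j hj).dual
  succ_of_mem_PStar j hj v hv := by
    rw [reduce_dual, dual_PStar] at hv
    rw [h.succ_of_mem_NStar j hj v hv, Finset.sum_range_succ]
    ring
  succ_of_mem_NStar j hj v hv := by
    rw [reduce_dual, dual_NStar] at hv
    rw [h.succ_of_mem_PStar j hj v hv, Finset.sum_range_succ]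
    ring

theorem one_le (h : G.IsRun Φ d l) {j : ℕ} (hj : j < l) : 1 ≤ d j := by
  exact_mod_cast (h.isDelta j hj).one_le

theorem le_sum (h : G.IsRun Φ d l) {j : ℕ} (hj : j ≤ l) :
    (j : ℤ) ≤ ∑ i ∈ Finset.range j, d i := by
  induction j with
  | zero => simp
  | succ j ih =>
    have := ih (by omega)
    have := h.one_le (j := j) (by omega)
    rw [Finset.sum_range_succ]
    push_cast
    omega

/-- The vertices that have been in `N*` up to the `j`-th game. -/
def alwaysN (G : MPGame V) (Φ : ℕ → V → ℤ) (j : ℕ) : Set V :=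
  {v | ∀ i ≤ j, v ∈ (G.reduce (Φ i)).NStar}

/-- The vertices that have been in `P*` up to the `j`-th game. -/
def alwaysP (G : MPGame V) (Φ : ℕ → V → ℤ) (j : ℕ) : Set V :=
  {v | ∀ i ≤ j, v ∈ (G.reduce (Φ i)).PStar}

theorem alwaysN_dual (G : MPGame V) (Φ : ℕ → V → ℤ) (d : ℕ → ℤ) (j : ℕ) :
    alwaysN G.dual (fun j v => ∑ i ∈ Finset.range j, d i - Φ j v) j = alwaysP G Φ j := by
  simp only [alwaysN, alwaysP, reduce_dual, dual_NStar]

theorem eq_zero_of_mem_alwaysN (h : G.IsRun Φ d l) {j : ℕ} (hj : j ≤ l) {v : V}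
    (hv : ∀ i < j, v ∈ (G.reduce (Φ i)).NStar) : Φ j v = 0 := by
  induction j with
  | zero => exact h.zero v
  | succ j ih =>
    rw [h.succ_of_mem_NStar j (by omega) v (hv j (by omega))]
    exact ih (by omega) fun i hi => hv i (by omega)

theorem eq_sum_of_mem_alwaysP (h : G.IsRun Φ d l) {j : ℕ} (hj : j ≤ l) {v : V}
    (hv : ∀ i < j, v ∈ (G.reduce (Φ i)).PStar) : Φ j v = ∑ i ∈ Finset.range j, d i := by
  have := h.dual.eq_zero_of_mem_alwaysN hj (v := v) fun i hi => by
    rw [reduce_dual, dual_NStar]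
    exact hv i hi
  omega

variable [Finite V]

theorem mem_or (hG : G.IsSimple) (φ : V → ℤ) (v : V) :
    v ∈ (G.reduce φ).NStar ∨ v ∈ (G.reduce φ).PStar := by
  rw [(hG.reduce φ).PStar_eq]
  exact em _

theorem le_succ (h : G.IsRun Φ d l) (hG : G.IsSimple) {j : ℕ} (hj : j < l) (v : V) :
    Φ j v ≤ Φ (j + 1) v ∧ Φ (j + 1) v ≤ Φ j v + d j := by
  have := h.one_le hj
  rcases mem_or hG (Φ j) v with h1 | h1
  · rw [h.succ_of_mem_NStar j hj v h1]; omega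
  · rw [h.succ_of_mem_PStar j hj v h1]; omega

theorem nonneg (h : G.IsRun Φ d l) (hG : G.IsSimple) {j : ℕ} (hj : j ≤ l) (v : V) :
    0 ≤ Φ j v := by
  induction j with
  | zero => exact (h.zero v).ge
  | succ j ih => exact (ih (by omega)).trans (h.le_succ hG (by omega) v).1

/-- Once a vertex has been in `N*`, Min can always avoid positive edges in it. -/
theorem minPre_nonpos (h : G.IsRun Φ d l) (hG : G.IsSimple) {j : ℕ} (hj : j ≤ l) {v : V}
    (hv : ∃ i ≤ j, v ∈ (G.reduce (Φ i)).NStar) :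
    (G.reduce (Φ j)).minPre (fun v v' => (G.reduce (Φ j)).weight v v' ≤ 0) v := by
  have base : ∀ j, v ∈ (G.reduce (Φ j)).NStar →
      (G.reduce (Φ j)).minPre (fun v v' => (G.reduce (Φ j)).weight v v' ≤ 0) v :=
    fun j hv => ((hG.reduce (Φ j)).minPre_of_mem_NStar hv).imp fun v' _ h' => by omega
  induction j with
  | zero =>
    obtain ⟨i, hi, hv⟩ := hv
    obtain rfl : i = 0 := by omega
    exact base 0 hv
  | succ j ih =>
    -- From `N*`, Min's edge stays in `N*` with unchanged weight, or has weight at most `-δ` and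
    -- gains `δ`. From `P*`, the source rises by `δ` and the target by no more, so no weight
    -- increases.
    rcases mem_or hG (Φ j) v with h1 | h1
    · have h0 := (h.isDelta j (by omega)).neg v h1
      rw [minPre_reduce] at h0 ⊢
      refine h0.imp fun v' _ h2 => ?_
      rw [reduce_weight, h.succ_of_mem_NStar j (by omega) v h1]
      rcases h2 with ⟨h2, h3⟩ | ⟨h2, h3⟩
      · rw [h.succ_of_mem_NStar j (by omega) v' h3]
        exact h2
      · rw [h.succ_of_mem_PStar j (by omega) v' h3]
        have h2 : d j ≤ -(G.reduce (Φ j)).weight v v' := by exact_mod_cast h2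
        rw [reduce_weight] at h2
        omega
    · obtain ⟨i, hi, hv⟩ := hv
      by_cases hij : i = j + 1
      · subst hij
        exact base _ hv
      · have h0 := ih (by omega) ⟨i, by omega, hv⟩
        rw [minPre_reduce] at h0 ⊢
        refine h0.imp fun v' _ h2 => ?_
        rw [reduce_weight] at h2 ⊢
        rw [h.succ_of_mem_PStar j (by omega) v h1]
        have := (h.le_succ hG (j := j) (by omega) v').2
        omega

theorem dual_minPre_nonneg (h : G.IsRun Φ d l) (hG : G.IsSimple) {j : ℕ} (hj : j ≤ l) {v : V}
    (hv : ∃ i ≤ j, v ∈ (G.reduce (Φ i)).PStar) :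
    (G.reduce (Φ j)).dual.minPre (fun v v' => 0 ≤ (G.reduce (Φ j)).weight v v') v := by
  have := h.dual.minPre_nonpos hG.dual hj (v := v)
  simp only [reduce_dual, dual_NStar] at this
  exact (this hv).imp fun v' _ h' => by simpa [dual_weight] using h'

/-- A nonempty part of `N*` without vertices that have always been in `N*` can be left by an edge
of weight zero that ends in `N*`. -/
theorem exists_zero_edge_of_NStar (h : G.IsRun Φ d l) (hG : G.IsSimple) {j : ℕ} (hj : j ≤ l)
    {X : Set V} (hne : X.Nonempty) (hX : X ⊆ (G.reduce (Φ j)).NStar)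
    (hd : ∀ v ∈ X, v ∉ alwaysN G Φ j) :
    ∃ x ∈ X, ∃ y ∈ (G.reduce (Φ j)).NStar, y ∉ X ∧ G.graph.Adj x y ∧
      (G.reduce (Φ j)).weight x y = 0 := by
  by_contra! hcon
  refine hne.ne_empty ((hG.reduce (Φ j)).eq_empty X fun v hv => ?_)
  have h1 : ∃ i ≤ j, v ∈ (G.reduce (Φ i)).PStar := by
    have := hd v hv
    simp only [alwaysN, Set.mem_ofPred_eq, not_forall] at this
    obtain ⟨i, hi, hi'⟩ := this
    exact ⟨i, hi, (mem_or hG (Φ i) v).resolve_left hi'⟩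
  -- Max can insist on a nonnegative weight here, so of Min's two options only a zero edge into `N*`
  -- remains.
  obtain ⟨v', h2, h3, h4⟩ := ((hG.reduce (Φ j)).minPre_of_mem_NStar (hX hv)).exists_and
    (h.dual_minPre_nonneg hG hj h1)
  rcases h3 with h3 | h3
  · omega
  · refine ⟨v', ?_, h2, h3.1⟩
    by_contra h5
    exact hcon v hv v' h3.2 h5 h2 h3.1

theorem exists_zero_edge_of_PStar (h : G.IsRun Φ d l) (hG : G.IsSimple) {j : ℕ} (hj : j ≤ l)
    {X : Set V} (hne : X.Nonempty) (hX : X ⊆ (G.reduce (Φ j)).PStar)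
    (hd : ∀ v ∈ X, v ∉ alwaysP G Φ j) :
    ∃ x ∈ X, ∃ y ∈ (G.reduce (Φ j)).PStar, y ∉ X ∧ G.graph.Adj x y ∧
      (G.reduce (Φ j)).weight x y = 0 := by
  have := h.dual.exists_zero_edge_of_NStar hG.dual hj hne
  simp only [reduce_dual, alwaysN_dual, dual_NStar, dual_weight, neg_eq_zero] at this
  exact this hX hd

theorem exists_mem_alwaysN (h : G.IsRun Φ d l) (hG : G.IsSimple) {j : ℕ} (hj : j ≤ l)
    (hne : (G.reduce (Φ j)).NStar.Nonempty) : (alwaysN G Φ j).Nonempty := by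
  by_contra hcon
  rw [Set.not_nonempty_iff_eq_empty] at hcon
  obtain ⟨x, _, y, h1, h2, _⟩ := h.exists_zero_edge_of_NStar hG hj hne subset_rfl (by simp [hcon])
  exact h2 h1

theorem exists_mem_alwaysP (h : G.IsRun Φ d l) (hG : G.IsSimple) {j : ℕ} (hj : j ≤ l)
    (hne : (G.reduce (Φ j)).PStar.Nonempty) : (alwaysP G Φ j).Nonempty := by
  rw [← alwaysN_dual G Φ d]
  refine h.dual.exists_mem_alwaysN hG.dual hj ?_
  rwa [reduce_dual, dual_NStar]

/-- A set that separates the vertices that have always been in `N*` from those that have always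
been in `P*` is crossed by an edge whose weight becomes zero in the next game. -/
theorem exists_crossing_edge (h : G.IsRun Φ d l) (hG : G.IsSimple) {j : ℕ} (hj : j < l)
    {X : Set V} (hN : alwaysN G Φ j ⊆ X) (hP : alwaysP G Φ j ⊆ Xᶜ) :
    ∃ x y, G.graph.Adj x y ∧ (x ∈ X ∧ y ∉ X ∨ x ∉ X ∧ y ∈ X) ∧
      (G.reduce (Φ (j + 1))).weight x y = 0 := by
  -- If `X` differs from `N*`, a zero edge inside `N*` or inside `P*` crosses it, and the update
  -- preserves its weight. If `X = N*`, the edge attaining `δ` crosses it and becomes zero.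
  rcases ((G.reduce (Φ j)).NStar ∩ Xᶜ).eq_empty_or_nonempty with h1 | h1
  · rcases ((G.reduce (Φ j)).PStar ∩ X).eq_empty_or_nonempty with h2 | h2
    · have h3 : ∀ v ∈ (G.reduce (Φ j)).NStar, v ∈ X := fun v hv => by
        by_contra h'
        exact Set.eq_empty_iff_forall_notMem.1 h1 v ⟨hv, h'⟩
      have h4 : ∀ v ∈ (G.reduce (Φ j)).PStar, v ∉ X := fun v hv h' =>
        Set.eq_empty_iff_forall_notMem.1 h2 v ⟨hv, h'⟩
      obtain ⟨x, y, hxy, h5⟩ := (h.isDelta j hj).attained _ rfl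
      refine ⟨x, y, hxy, ?_⟩
      rw [reduce_weight] at h5 ⊢
      rcases h5 with ⟨hx, hy, h5⟩ | ⟨hx, hy, h5⟩
      · refine ⟨Or.inl ⟨h3 _ hx, h4 _ hy⟩, ?_⟩
        rw [h.succ_of_mem_NStar j hj x hx, h.succ_of_mem_PStar j hj y hy]
        omega
      · refine ⟨Or.inr ⟨h4 _ hx, h3 _ hy⟩, ?_⟩
        rw [h.succ_of_mem_NStar j hj y hy, h.succ_of_mem_PStar j hj x hx]
        omega
    · obtain ⟨x, hx, y, hy, hyX, hxy, hw⟩ := h.exists_zero_edge_of_PStar hG hj.le h2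
        Set.inter_subset_left fun v hv h' => hP h' hv.2
      refine ⟨x, y, hxy, Or.inl ⟨hx.2, fun h' => hyX ⟨hy, h'⟩⟩, ?_⟩
      rw [reduce_weight] at hw ⊢
      rw [h.succ_of_mem_PStar j hj x hx.1, h.succ_of_mem_PStar j hj y hy]
      omega
  · obtain ⟨x, hx, y, hy, hyX, hxy, hw⟩ := h.exists_zero_edge_of_NStar hG hj.le h1
      Set.inter_subset_left fun v hv h' => hv.2 (hN h')
    refine ⟨x, y, hxy, Or.inr ⟨hx.2, by_contra fun h' => hyX ⟨hy, h'⟩⟩, ?_⟩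
    rw [reduce_weight] at hw ⊢
    rw [h.succ_of_mem_NStar j hj x hx.1, h.succ_of_mem_NStar j hj y hy]
    omega

end IsRun

/-- If the values of `f` on `S` start with `0` and have no gaps larger than `N`, then they are at
most `(|S| - 1) N`. -/
theorem add_le_card_mul_of_no_gap (S : Finset V) (f : V → ℤ) (N : ℕ) {t v : V} (ht : t ∈ S)
    (ht0 : f t = 0) (hv : v ∈ S)
    (h : ∀ c, 0 ≤ c → c < f v → ∃ x ∈ S, ∃ y ∈ S, c < f x ∧ f y ≤ c ∧ f x - f y ≤ N) :
    f v + N ≤ S.card * N := by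
  classical
  -- Each threshold `k * N` below `f v` is jumped by at most `N`, so raising it by `N` captures a
  -- new element.
  have key : ∀ k : ℕ, (k : ℤ) * N < f v → k + 1 ≤ (S.filter fun u => f u ≤ k * N).card := by
    intro k
    induction k with
    | zero =>
      intro _
      exact Finset.card_pos.2 ⟨t, by simp [ht, ht0]⟩
    | succ k ih =>
      intro hk
      push_cast at hk
      have hk' : (k : ℤ) * N < f v := by nlinarith
      obtain ⟨x, hx, y, hy, h1, h2, h3⟩ := h (k * N) (by positivity) hk'
      refine lt_of_le_of_lt (ih hk') (Finset.card_lt_card ?_)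
      rw [Finset.ssubset_iff]
      refine ⟨x, by simp [hx, h1], ?_⟩
      intro u hu
      simp only [Finset.mem_insert, Finset.mem_filter] at hu ⊢
      push_cast
      rcases hu with rfl | ⟨hu, hu'⟩
      · exact ⟨hx, by linarith⟩
      · exact ⟨hu, by nlinarith⟩
  rcases le_or_gt (f v) 0 with h0 | h0
  · have : 1 ≤ S.card := Finset.card_pos.2 ⟨t, ht⟩
    nlinarith
  · have hN : 0 < (N : ℤ) := by
      obtain ⟨x, _, y, _, h1, h2, h3⟩ := h 0 le_rfl h0
      omega
    -- This is the largest `k` with `k * N < f v`, so `f v ≤ (k + 1) * N`; as `v` itself is not yet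
    -- counted, `k + 2 ≤ |S|`.
    obtain ⟨k, hk⟩ := Int.eq_ofNat_of_zero_le (Int.ediv_nonneg (by omega : 0 ≤ f v - 1) hN.le)
    have h1 := Int.mul_ediv_add_emod (f v - 1) N
    have h2 := Int.emod_nonneg (f v - 1) hN.ne'
    have h3 := Int.emod_lt_of_pos (f v - 1) hN
    rw [hk] at h1
    have h4 : (k : ℤ) * N < f v := by nlinarith
    have h5 := key k h4
    have h6 : (S.filter fun u => f u ≤ k * N).card < S.card := by
      refine Finset.card_lt_card ?_
      rw [Finset.filter_ssubset]
      exact ⟨v, hv, by omega⟩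
    have h7 : (k : ℤ) + 2 ≤ S.card := by exact_mod_cast (by omega : k + 2 ≤ S.card)
    nlinarith

variable [Fintype V]

theorem abs_weight_le {G : MPGame V} {x y : V} (h : G.graph.Adj x y) :
    |G.weight x y| ≤ G.maxWeight := by
  have := Finset.le_sup (f := fun e : V × V => (G.weight e.1 e.2).natAbs)
    (mem_edgesBetween.2 ⟨h, Set.mem_univ x, Set.mem_univ y⟩)
  rw [Int.abs_eq_natAbs]
  exact_mod_cast this

theorem dual_maxWeight (G : MPGame V) : G.dual.maxWeight = G.maxWeight := by
  simp only [maxWeight, dual_weight, Int.natAbs_neg]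
  rfl

namespace IsRun

variable {G : MPGame V} {Φ : ℕ → V → ℤ} {d : ℕ → ℤ} {l : ℕ}

theorem sum_le (h : G.IsRun Φ d l) (hG : G.IsSimple) :
    ∑ i ∈ Finset.range l, d i ≤ Fintype.card V * G.maxWeight := by
  rcases l.eq_zero_or_pos with rfl | hl
  · simp only [Finset.range_zero, Finset.sum_empty]
    positivity
  obtain ⟨j, rfl⟩ : ∃ j, l = j + 1 := ⟨l - 1, by omega⟩
  obtain ⟨x, y, hxy, h1⟩ := (h.isDelta j (by omega)).attained _ rfl
  have hne : (G.reduce (Φ j)).NStar.Nonempty ∧ (G.reduce (Φ j)).PStar.Nonempty := by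
    rcases h1 with h1 | h1
    · exact ⟨⟨x, h1.1⟩, ⟨y, h1.2.1⟩⟩
    · exact ⟨⟨y, h1.2.1⟩, ⟨x, h1.1⟩⟩
  have hN0 : ∀ t ∈ alwaysN G Φ j, Φ (j + 1) t = 0 := fun t ht =>
    h.eq_zero_of_mem_alwaysN le_rfl fun i hi => ht i (by omega)
  have hPs : ∀ t ∈ alwaysP G Φ j, Φ (j + 1) t = ∑ i ∈ Finset.range (j + 1), d i := fun t ht =>
    h.eq_sum_of_mem_alwaysP le_rfl fun i hi => ht i (by omega)
  obtain ⟨t, ht⟩ := h.exists_mem_alwaysN hG (by omega) hne.1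
  obtain ⟨u, hu⟩ := h.exists_mem_alwaysP hG (by omega) hne.2
  have := add_le_card_mul_of_no_gap Finset.univ (Φ (j + 1)) G.maxWeight (Finset.mem_univ t)
    (hN0 t ht) (Finset.mem_univ u) fun c hc hcu => by
      -- The threshold set separates, because `Φ` is 0 on the always-`N*` vertices and exceeds `c`
      -- on the always-`P*` vertices.
      obtain ⟨x, y, hxy, h2, h3⟩ := h.exists_crossing_edge hG (j := j) (by omega)
        (X := {v | Φ (j + 1) v ≤ c}) (fun v hv => by simp [hN0 v hv, hc])
        (fun v hv => by rw [hPs u hu] at hcu; simp [hPs v hv, hcu])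
      have h4 := abs_le.1 (abs_weight_le hxy)
      rw [reduce_weight] at h3
      simp only [Set.mem_ofPred_eq, not_le] at h2
      rcases h2 with h2 | h2
      · exact ⟨y, Finset.mem_univ y, x, Finset.mem_univ x, h2.2, h2.1, by omega⟩
      · exact ⟨x, Finset.mem_univ x, y, Finset.mem_univ y, h2.1, h2.2, by omega⟩
  rw [hPs u hu, Finset.card_univ] at this
  omega

open Classical in
theorem add_le_card_NStar_mul (h : G.IsRun Φ d l) (hG : G.IsSimple) {v : V}
    (hv : v ∈ (G.reduce (Φ l)).NStar) :
    Φ l v + G.maxWeight ≤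
      (Finset.univ.filter fun u => u ∈ (G.reduce (Φ l)).NStar).card * G.maxWeight := by
  have hN0 : ∀ t ∈ alwaysN G Φ l, Φ l t = 0 := fun t ht =>
    h.eq_zero_of_mem_alwaysN le_rfl fun i hi => ht i (by omega)
  obtain ⟨t, ht⟩ := h.exists_mem_alwaysN hG le_rfl ⟨v, hv⟩
  refine add_le_card_mul_of_no_gap _ (Φ l) G.maxWeight (t := t) ?_ (hN0 t ht) ?_ ?_
  · simpa using ht l le_rfl
  · simpa using hv
  · intro c hc hcv
    obtain ⟨x, hx, y, hy, h1, hxy, h2⟩ := h.exists_zero_edge_of_NStar hG le_rfl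
      (X := {u | u ∈ (G.reduce (Φ l)).NStar ∧ c < Φ l u}) ⟨v, hv, hcv⟩ (fun u hu => hu.1)
      (fun u hu h' => by have := hN0 u h'; have := hu.2; omega)
    have h4 := abs_le.1 (abs_weight_le hxy)
    rw [reduce_weight] at h2
    have h3 : Φ l y ≤ c := by
      by_contra h'
      exact h1 ⟨hy, by omega⟩
    exact ⟨x, by simpa using hx.1, y, by simpa using hy, hx.2, h3, by omega⟩

end IsRun

end

/-! ### Energy values and the final potential -/

section

variable {V : Type*}

/-- The edges that can be used when Min plays according to `σ`. -/
def Moves (G : MPGame V) (σ : G.Strategy G.VMin) (v v' : V) : Prop :=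
  G.graph.Adj v v' ∧ ∀ h : v ∈ G.VMin, v' = σ.1 ⟨v, h⟩

/-- `f` is nonnegative on `A`, and the moves consistent with `σ` do not leave `A` and lower `f` at
least by their weights. -/
def IsBound (G : MPGame V) (σ : G.Strategy G.VMin) (A : Set V) (f : V → ℤ) : Prop :=
  ∀ v ∈ A, 0 ≤ f v ∧ ∀ v', G.Moves σ v v' → v' ∈ A ∧ G.weight v v' + f v' ≤ f v

theorem moves_of_mem_plays {G : MPGame V} {σ : G.Strategy G.VMin} {v : V} {π : ℕ → V}
    (h : π ∈ G.plays σ v) (i : ℕ) : G.Moves σ (π i) (π (i + 1)) :=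
  ⟨h.1.2 i, fun h' => h.2 i h'⟩

theorem plays_nonempty (G : MPGame V) (σ : G.Strategy G.VMin) (v : V) :
    (G.plays σ v).Nonempty := by
  choose s hs using G.noSink
  obtain ⟨π, h, _⟩ := G.exists_play σ ⟨fun v => s v, fun v => hs v⟩ v
  exact ⟨π, h⟩

theorem cons_mem_plays {G : MPGame V} {σ : G.Strategy G.VMin} {v v' : V} {π : ℕ → V}
    (h : G.Moves σ v v') (hπ : π ∈ G.plays σ v') :
    (fun i => Nat.casesOn i v π : ℕ → V) ∈ G.plays σ v := by
  obtain ⟨⟨h0, hp⟩, hc⟩ := hπ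
  subst h0
  refine ⟨⟨rfl, fun i => ?_⟩, fun i => ?_⟩
  · cases i with
    | zero => exact h.1
    | succ i => exact hp i
  · cases i with
    | zero => exact h.2
    | succ i => exact hc i

/-- A strategy that keeps the energy bounded has a bound for the energy that is compatible with
its moves. -/
theorem exists_isBound {G : MPGame V} {σ : G.Strategy G.VMin} {v : V} {M : ℤ}
    (hM : ∀ π ∈ G.plays σ v, ∀ k, ∑ i ∈ Finset.range k, G.weights π i ≤ M) :
    ∃ A f, G.IsBound σ A f ∧ v ∈ A ∧ f v ≤ M := by
  let S : V → Set ℤ := fun u =>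
    {s | ∃ π ∈ G.plays σ u, ∃ k, ∑ i ∈ Finset.range k, G.weights π i = s}
  have h0 : ∀ u, 0 ∈ S u := fun u => by
    obtain ⟨π, hπ⟩ := G.plays_nonempty σ u
    exact ⟨π, hπ, 0, rfl⟩
  have hS : ∀ u u', G.Moves σ u u' → ∀ s ∈ S u', G.weight u u' + s ∈ S u := by
    rintro u u' hu s ⟨π, hπ, k, rfl⟩
    refine ⟨_, cons_mem_plays hu hπ, k + 1, ?_⟩
    rw [Finset.sum_range_succ', add_comm]
    congr 1
    simp only [weights]
    rw [← hπ.1.1]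
    rfl
  have hv : M ∈ upperBounds (S v) := by
    rintro s ⟨π, hπ, k, rfl⟩
    exact hM π hπ k
  -- The bound is the exact energy under `σ`, on the vertices where it is finite; a bounded set of
  -- integers attains its supremum.
  refine ⟨{u | BddAbove (S u)}, fun u => sSup (S u), fun u hu => ⟨le_csSup hu (h0 u), ?_⟩,
    ⟨M, hv⟩, csSup_le ⟨0, h0 v⟩ hv⟩
  intro u' huu'
  obtain ⟨b, hb⟩ := hu
  have hu' : BddAbove (S u') := ⟨b - G.weight u u', fun s hs => by
    have := hb (hS u u' huu' s hs)
    omega⟩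
  exact ⟨hu', le_csSup ⟨b, hb⟩ (hS u u' huu' _ (Int.csSup_mem ⟨0, h0 u'⟩ hu'))⟩

theorem minPre.exists_moves {G : MPGame V} {Q : V → V → Prop} {v : V}
    (h : G.dual.minPre Q v) (σ : G.Strategy G.VMin) : ∃ v', G.Moves σ v v' ∧ Q v v' := by
  by_cases hv : v ∈ G.VMin
  · refine ⟨σ.1 ⟨v, hv⟩, ⟨σ.2 ⟨v, hv⟩, fun _ => rfl⟩, ?_⟩
    exact h.2 (by simpa [dual] using hv) _ (σ.2 ⟨v, hv⟩)
  · obtain ⟨v', h1, h2⟩ := h.1 hv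
    exact ⟨v', ⟨h1, fun h => absurd h hv⟩, h2⟩

/-- The energies of the vertices of `P*` are at least `δ`. -/
theorem IsDelta.le_of_isBound [Finite V] {G : MPGame V} {d : WithTop ℤ} (h : G.IsDelta d)
    (hG : G.IsSimple) {σ : G.Strategy G.VMin} {A : Set V} {f : V → ℤ} (hA : G.IsBound σ A f)
    {v : V} (hv : v ∈ A) (hP : v ∈ G.PStar) {c : ℤ} (hc : (c : WithTop ℤ) ≤ d) : c ≤ f v := by
  by_contra hlt
  let B : Set V := {u | u ∈ A ∧ u ∈ G.PStar ∧ f u < c}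
  -- An edge to `N*` of weight at least `d` would force `f u ≥ c`, so Max's move stays in `B`. Where
  -- `f` is minimal on `B`, these moves have weight zero and preserve `f`, contradicting simplicity.
  have hB : ∀ u ∈ B, ∃ u' ∈ B, G.graph.Adj u u' ∧ 0 ≤ G.weight u u' ∧
      G.weight u u' + f u' ≤ f u := by
    rintro u ⟨hu, huP, huc⟩
    obtain ⟨u', h1, h2⟩ := (h.pos u huP).exists_moves σ
    obtain ⟨h3, h4⟩ := (hA u hu).2 u' h1
    rcases h2 with ⟨h2, h5⟩ | ⟨h2, h5⟩
    · exact ⟨u', ⟨h3, h5, by omega⟩, h1.1, h2, h4⟩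
    · have h6 : c ≤ G.weight u u' := by exact_mod_cast hc.trans h2
      have := (hA u' h3).1
      omega
  obtain ⟨m, hm, hmin⟩ := Set.exists_min_image B f (Set.toFinite B) ⟨v, hv, hP, by omega⟩
  have := hG.eq_empty {u | u ∈ B ∧ f u = f m} fun u hu => by
    obtain ⟨u', h1, h2, h3, h4⟩ := hB u hu.1
    have h5 := hmin u' h1
    have h6 := hu.2
    exact ⟨u', ⟨h1, by omega⟩, h2, by omega⟩
  exact Set.eq_empty_iff_forall_notMem.1 this m ⟨hm, rfl⟩

theorem IsBound.reduce {G : MPGame V} {σ : G.Strategy G.VMin} {A : Set V} {f : V → ℤ}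
    (hA : G.IsBound σ A f) {φ : V → ℤ} (h : ∀ v ∈ A, φ v ≤ f v) :
    (G.reduce φ).IsBound σ A (fun v => f v - φ v) := by
  intro v hv
  refine ⟨sub_nonneg.2 (h v hv), fun v' h1 => ?_⟩
  obtain ⟨h2, h3⟩ := (hA v hv).2 v' h1
  refine ⟨h2, ?_⟩
  simp only [reduce_weight]
  omega

namespace IsRun

variable {G : MPGame V} {Φ : ℕ → V → ℤ} {d : ℕ → ℤ} {l : ℕ}

theorem le_of_isBound [Finite V] (h : G.IsRun Φ d l) (hG : G.IsSimple) {σ : G.Strategy G.VMin}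
    {A : Set V} {f : V → ℤ} (hA : G.IsBound σ A f) {j : ℕ} (hj : j ≤ l) :
    ∀ v ∈ A, Φ j v ≤ f v := by
  induction j with
  | zero =>
    intro v hv
    rw [h.zero]
    exact (hA v hv).1
  | succ j ih =>
    intro v hv
    have ih := ih (by omega)
    rcases mem_or hG (Φ j) v with h1 | h1
    · rw [h.succ_of_mem_NStar j (by omega) v h1]
      exact ih v hv
    · rw [h.succ_of_mem_PStar j (by omega) v h1]
      -- In the current game the bound is `f - Φ j`, and it is at least `δ` on `P*`.
      have := (h.isDelta j (by omega)).le_of_isBound (hG.reduce _) (hA.reduce ih) hv h1 le_rfl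
      omega

theorem le_energy [Finite V] (h : G.IsRun Φ d l) (hG : G.IsSimple)
    (ht : (G.reduce (Φ l)).IsDelta ⊤) {σ : G.Strategy G.VMin} {v : V} {M : ℤ}
    (hM : ∀ π ∈ G.plays σ v, ∀ k, ∑ i ∈ Finset.range k, G.weights π i ≤ M) :
    v ∈ (G.reduce (Φ l)).NStar ∧ Φ l v ≤ M := by
  obtain ⟨A, f, hA, hv, hf⟩ := exists_isBound hM
  have h1 := h.le_of_isBound hG hA le_rfl
  refine ⟨(mem_or hG (Φ l) v).resolve_right fun h2 => ?_, (h1 v hv).trans hf⟩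
  -- With `δ = ∞` every integer is a lower bound on `P*`, even one above the finite energy.
  have := ht.le_of_isBound (hG.reduce _) (hA.reduce h1) hv h2 (c := f v - Φ l v + 1) le_top
  omega

/-- When `δ = ∞`, Min can stay in `N*` along nonpositive reduced weights. The original sums
telescope to at most `Φ l v - Φ l (π k)`, and `Φ` is nonnegative. -/
theorem exists_energy_le [Finite V] (h : G.IsRun Φ d l) (hG : G.IsSimple)
    (ht : (G.reduce (Φ l)).IsDelta ⊤) : ∃ σ : G.Strategy G.VMin,
      ∀ v ∈ (G.reduce (Φ l)).NStar, ∀ π ∈ G.plays σ v, ∀ k,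
        ∑ i ∈ Finset.range k, G.weights π i ≤ Φ l v := by
  obtain ⟨σ, hσ⟩ := (G.reduce (Φ l)).exists_strategy_minPre
    (fun v v' => (G.reduce (Φ l)).weight v v' ≤ 0 ∧ v' ∈ (G.reduce (Φ l)).NStar)
  refine ⟨σ, fun v hv π hπ k => ?_⟩
  have key : ∀ k, π k ∈ (G.reduce (Φ l)).NStar ∧
      ∑ i ∈ Finset.range k, G.weights π i ≤ Φ l v - Φ l (π k) := by
    intro k
    induction k with
    | zero =>
      rw [hπ.1.1]
      exact ⟨hv, by simp⟩
    | succ k ih =>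
      obtain ⟨h1, h2⟩ := ih
      have h3 := moves_of_mem_plays hπ k
      obtain ⟨h4, h5⟩ := hσ (π k) ((ht.neg _ h1).imp fun v' _ h' => h'.resolve_right
        fun h' => WithTop.coe_ne_top (top_le_iff.1 h'.1)) _ h3.1 h3.2
      refine ⟨h5, ?_⟩
      rw [reduce_weight] at h4
      rw [Finset.sum_range_succ]
      simp only [weights] at h2 ⊢
      omega
  have := (key k).2
  have := h.nonneg hG le_rfl (π k)
  omega

end IsRun

theorem iSup_energy_le_iff {G : MPGame V} {σ : G.Strategy G.VMin} {v : V} {x : EReal} :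
    ⨆ π ∈ G.plays σ v, energy (G.weights π) ≤ x ↔ ∀ π ∈ G.plays σ v, ∀ k,
      (((∑ i ∈ Finset.range k, G.weights π i : ℤ) : ℝ) : EReal) ≤ x := by
  simp only [iSup_le_iff, energy]

namespace IsRun

variable {G : MPGame V} {Φ : ℕ → V → ℤ} {d : ℕ → ℤ} {l : ℕ}

theorem energyValue_of_mem_PStar [Finite V] (h : G.IsRun Φ d l) (hG : G.IsSimple)
    (ht : (G.reduce (Φ l)).IsDelta ⊤) {v : V} (hv : v ∈ (G.reduce (Φ l)).PStar) :
    G.energyValue v = ⊤ := by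
  refine iInf_eq_top.2 fun σ => ?_
  by_contra hne
  obtain ⟨r, h1, _⟩ := EReal.lt_iff_exists_real_btwn.1 (lt_top_iff_ne_top.2 hne)
  have h2 := iSup_energy_le_iff.1 h1.le
  have h3 := (h.le_energy hG ht (σ := σ) (v := v) (M := ⌊r⌋) fun π hπ k =>
    Int.le_floor.2 (by exact_mod_cast h2 π hπ k)).1
  exact NStar_disjoint_PStar _ h3 hv

theorem energyValue_of_mem_NStar [Finite V] (h : G.IsRun Φ d l) (hG : G.IsSimple)
    (ht : (G.reduce (Φ l)).IsDelta ⊤) {v : V} (hv : v ∈ (G.reduce (Φ l)).NStar) :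
    G.energyValue v = ((Φ l v : ℝ) : EReal) := by
  apply le_antisymm
  · obtain ⟨σ, hσ⟩ := h.exists_energy_le hG ht
    refine iInf_le_of_le σ (iSup_energy_le_iff.2 fun π hπ k => ?_)
    exact_mod_cast hσ v hv π hπ k
  · refine le_iInf fun σ => ?_
    by_contra hlt
    push Not at hlt
    have h2 := (iSup_energy_le_iff (G := G) (σ := σ) (v := v)).1 le_rfl
    have h3 := (h.le_energy hG ht (σ := σ) (v := v) (M := Φ l v - 1) fun π hπ k => by
      have h4 := (h2 π hπ k).trans_lt hlt
      have h5 : ∑ i ∈ Finset.range k, G.weights π i < Φ l v := by exact_mod_cast h4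
      omega).2
    omega

end IsRun

variable [Fintype V]

theorem dual_maxEnergy (G : MPGame V) : G.dual.maxEnergy = G.maxDualEnergy := by
  simp only [maxEnergy, maxDualEnergy, dual_energyValue, ne_eq, EReal.neg_eq_top_iff]

namespace IsRun

variable {G : MPGame V} {Φ : ℕ → V → ℤ} {d : ℕ → ℤ} {l : ℕ}

theorem le_maxEnergy (h : G.IsRun Φ d l) (hG : G.IsSimple)
    (ht : (G.reduce (Φ l)).IsDelta ⊤) {v : V} (hv : v ∈ (G.reduce (Φ l)).NStar) :
    (Φ l v : ℝ) ≤ G.maxEnergy := by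
  classical
  have h1 := h.energyValue_of_mem_NStar hG ht hv
  have h2 : (G.energyValue v).toENNReal.toNNReal ≤ G.maxEnergy :=
    Finset.le_sup (f := fun v => (G.energyValue v).toENNReal.toNNReal) (by simp [h1])
  rw [h1, EReal.toENNReal_of_ne_top (EReal.coe_ne_top _), EReal.toReal_coe] at h2
  exact Real.toNNReal_le_iff_le_coe.1 h2

open Classical in
theorem maxEnergy_add_le (h : G.IsRun Φ d l) (hG : G.IsSimple)
    (ht : (G.reduce (Φ l)).IsDelta ⊤) (hne : (G.reduce (Φ l)).NStar.Nonempty) :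
    (G.maxEnergy : ℝ) + G.maxWeight ≤
      (Finset.univ.filter fun u => u ∈ (G.reduce (Φ l)).NStar).card * G.maxWeight := by
  have hfin : ∀ v, G.energyValue v ≠ ⊤ ↔ v ∈ (G.reduce (Φ l)).NStar := by
    intro v
    constructor
    · intro h1
      exact (mem_or hG (Φ l) v).resolve_right fun h2 =>
        h1 (h.energyValue_of_mem_PStar hG ht h2)
    · intro h1
      rw [h.energyValue_of_mem_NStar hG ht h1]
      exact EReal.coe_ne_top _
  obtain ⟨v, hv, hmax⟩ := Finset.exists_mem_eq_sup
    (Finset.univ.filter fun v => G.energyValue v ≠ ⊤)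
    (hne.imp fun v hv => by simpa using (hfin v).2 hv)
    (fun v => (G.energyValue v).toENNReal.toNNReal)
  have hv : v ∈ (G.reduce (Φ l)).NStar := (hfin v).1 (by simpa using hv)
  have h1 : (G.maxEnergy : ℝ) = Φ l v := by
    have h2 : (0 : ℝ) ≤ Φ l v := by exact_mod_cast h.nonneg hG le_rfl v
    rw [maxEnergy, hmax, h.energyValue_of_mem_NStar hG ht hv,
      EReal.toENNReal_of_ne_top (EReal.coe_ne_top _), EReal.toReal_coe]
    exact Real.coe_toNNReal _ h2
  rw [h1]
  exact_mod_cast h.add_le_card_NStar_mul hG hv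

theorem maxEnergy_eq_zero (h : G.IsRun Φ d l) (hG : G.IsSimple)
    (ht : (G.reduce (Φ l)).IsDelta ⊤) (hne : (G.reduce (Φ l)).NStar = ∅) :
    G.maxEnergy = 0 := by
  classical
  refine le_antisymm (Finset.sup_le fun v hv => ?_) bot_le
  refine absurd ?_ (Finset.mem_filter.1 hv).2
  refine h.energyValue_of_mem_PStar hG ht ((mem_or hG (Φ l) v).resolve_left ?_)
  simp [hne]

theorem sum_le_maxWeight_add (h : G.IsRun Φ d l) (hG : G.IsSimple)
    (ht : (G.reduce (Φ l)).IsDelta ⊤) :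
    ((∑ i ∈ Finset.range l, d i : ℤ) : ℝ) ≤ G.maxWeight + G.maxEnergy + G.maxDualEnergy := by
  have hE : ∀ v ∈ (G.reduce (Φ l)).NStar, (Φ l v : ℝ) ≤ G.maxEnergy := fun v hv =>
    h.le_maxEnergy hG ht hv
  have hE' : ∀ v ∈ (G.reduce (Φ l)).PStar,
      ((∑ i ∈ Finset.range l, d i : ℤ) : ℝ) - Φ l v ≤ G.maxDualEnergy := fun v hv => by
    have := h.dual.le_maxEnergy hG.dual (v := v)
    simp only [reduce_dual, dual_NStar, dual_maxEnergy] at this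
    exact_mod_cast this ht.dual hv
  have hN : (0 : ℝ) ≤ G.maxWeight := by positivity
  have h0 : (0 : ℝ) ≤ G.maxEnergy := G.maxEnergy.2
  have h0' : (0 : ℝ) ≤ G.maxDualEnergy := G.maxDualEnergy.2
  rcases l.eq_zero_or_pos with rfl | hl
  · simp only [Finset.range_zero, Finset.sum_empty, Int.cast_zero]
    positivity
  obtain ⟨j, rfl⟩ : ∃ j, l = j + 1 := ⟨l - 1, by omega⟩
  -- Either the final `N*` separates and a crossing edge gives the bound, or an always-`N*` or
  -- always-`P*` vertex has just changed sides. In the latter case `D` is itself at most `E⁻` or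
  -- `E⁺`.
  by_cases h1 : alwaysN G Φ j ⊆ (G.reduce (Φ (j + 1))).NStar
  · by_cases h2 : alwaysP G Φ j ⊆ (G.reduce (Φ (j + 1))).NStarᶜ
    · obtain ⟨x, y, hxy, h3, h4⟩ := h.exists_crossing_edge hG (by omega) h1 h2
      have h5 := abs_le.1 (abs_weight_le hxy)
      rw [reduce_weight] at h4
      have h6 : (-(G.maxWeight : ℝ) ≤ Φ (j + 1) x - Φ (j + 1) y) ∧
          (Φ (j + 1) x - Φ (j + 1) y : ℝ) ≤ G.maxWeight := by
        constructor
        · exact_mod_cast (by omega : -(G.maxWeight : ℤ) ≤ Φ (j + 1) x - Φ (j + 1) y)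
        · exact_mod_cast (by omega : Φ (j + 1) x - Φ (j + 1) y ≤ (G.maxWeight : ℤ))
      rcases h3 with ⟨hx, hy⟩ | ⟨hx, hy⟩
      · have := hE x hx
        have := hE' y ((mem_or hG _ y).resolve_left hy)
        linarith
      · have := hE y hy
        have := hE' x ((mem_or hG _ x).resolve_left hx)
        linarith
    · obtain ⟨t, ht1, ht2⟩ := Set.not_subset.1 h2
      have := hE t (not_not.1 ht2)
      rw [h.eq_sum_of_mem_alwaysP le_rfl fun i hi => ht1 i (by omega)] at this
      linarith
  · obtain ⟨t, ht1, ht2⟩ := Set.not_subset.1 h1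
    have := hE' t ((mem_or hG _ t).resolve_left ht2)
    rw [h.eq_zero_of_mem_alwaysN le_rfl fun i hi => ht1 i (by omega)] at this
    push_cast at this ⊢
    linarith

theorem add_le_card_mul (h : G.IsRun Φ d l) (hG : G.IsSimple)
    (ht : (G.reduce (Φ l)).IsDelta ⊤) :
    (G.maxWeight + G.maxEnergy + G.maxDualEnergy : ℝ) ≤ Fintype.card V * G.maxWeight := by
  classical
  have hcard : (Finset.univ.filter fun u => u ∈ (G.reduce (Φ l)).NStar).card +
      (Finset.univ.filter fun u => u ∈ (G.reduce (Φ l)).PStar).card = Fintype.card V := by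
    rw [(hG.reduce (Φ l)).PStar_eq]
    convert Finset.card_filter_add_card_filter_not (s := Finset.univ)
      (fun u => u ∈ (G.reduce (Φ l)).NStar)
    exact Finset.card_univ.symm
  have hN : (0 : ℝ) ≤ G.maxWeight := by positivity
  have hcard : ((Finset.univ.filter fun u => u ∈ (G.reduce (Φ l)).NStar).card : ℝ) +
      (Finset.univ.filter fun u => u ∈ (G.reduce (Φ l)).PStar).card = Fintype.card V := by
    exact_mod_cast hcard
  have h1 := h.maxEnergy_add_le hG ht
  have h2 := h.dual.maxEnergy_add_le hG.dual
  have h3 := h.maxEnergy_eq_zero hG ht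
  have h4 := h.dual.maxEnergy_eq_zero hG.dual
  simp only [reduce_dual, dual_NStar, dual_maxEnergy, dual_maxWeight] at h2 h4
  rw [← hcard, add_mul]
  -- The bound for one side needs a vertex there; an empty side contributes 0. If both are empty,
  -- there are no vertices and `N = 0`.
  rcases (G.reduce (Φ l)).NStar.eq_empty_or_nonempty with hn | hn
  · rw [h3 hn]
    rcases (G.reduce (Φ l)).PStar.eq_empty_or_nonempty with hp | hp
    · rw [h4 ht.dual hp]
      have hV : IsEmpty V := ⟨fun v => by
        rcases mem_or hG (Φ l) v with h | h
        · simp [hn] at h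
        · simp [hp] at h⟩
      have hw : G.maxWeight = 0 := by
        simp [maxWeight, Finset.univ_eq_empty, edgesBetween]
      simp [hw]
    · have := h2 ht.dual hp
      have : (0 : ℝ) ≤ (Finset.univ.filter fun u => u ∈ (G.reduce (Φ l)).NStar).card *
        G.maxWeight := by positivity
      push_cast
      linarith
  · have h1 := h1 hn
    rcases (G.reduce (Φ l)).PStar.eq_empty_or_nonempty with hp | hp
    · rw [h4 ht.dual hp]
      have : (0 : ℝ) ≤ (Finset.univ.filter fun u => u ∈ (G.reduce (Φ l)).PStar).card *
        G.maxWeight := by positivity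
      push_cast
      linarith
    · have := h2 ht.dual hp
      linarith

end IsRun

/-! ### The iteration as a run, and the conclusion -/

/-- The sum of the potentials of the first `j` steps of the iteration. -/
def totalPotential (G : MPGame V) (j : ℕ) (v : V) : ℤ :=
  ∑ i ∈ Finset.range j, (G.gkkGame i).gkkPotential v

theorem gkkGame_eq (G : MPGame V) (j : ℕ) : G.gkkGame j = G.reduce (G.totalPotential j) := by
  induction j with
  | zero => exact G.reduce_zero.symm
  | succ j ih =>
    rw [gkkGame]
    nth_rewrite 1 [ih]
    rw [reduce_reduce]
    congr 1
    funext v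
    rw [totalPotential, totalPotential, Finset.sum_range_succ]

theorem isDelta_gkkGame {G : MPGame V} (hG : G.IsSimple) (j : ℕ) :
    (G.reduce (G.totalPotential j)).IsDelta (G.gkkGame j).delta := by
  rw [gkkGame_eq]
  exact (hG.reduce _).isDelta

theorem isRun_totalPotential {G : MPGame V} (hG : G.IsSimple) {l : ℕ}
    (hl : ∀ j < l, (G.gkkGame j).delta ≠ ⊤) :
    G.IsRun G.totalPotential (fun j => (G.gkkGame j).delta.untopD 0) l where
  zero v := rfl
  isDelta j hj := by
    have := isDelta_gkkGame hG j
    lift (G.gkkGame j).delta to ℤ using hl j hj with e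
    exact this
  succ_of_mem_PStar j hj v hv := by
    rw [← gkkGame_eq] at hv
    rw [totalPotential, Finset.sum_range_succ, gkkPotential, if_pos hv]
    rfl
  succ_of_mem_NStar j hj v hv := by
    rw [← gkkGame_eq] at hv
    rw [totalPotential, Finset.sum_range_succ, gkkPotential,
      if_neg (NStar_disjoint_PStar _ hv), add_zero]
    rfl

end

end MPGame

end

theorem theorem4p1 {V : Type*} [Fintype V] (G : MPGame V) (hG : G.IsSimple) :
    (∃ s : ℕ, G.StopsAfter s ∧
      (s : ℝ) ≤ G.maxWeight + G.maxEnergy + G.maxDualEnergy + 1) ∧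
    (G.maxWeight + G.maxEnergy + G.maxDualEnergy + 1 : ℝ) ≤
      (Fintype.card V : ℝ) * G.maxWeight + 1 := by
  have hfinite : ∃ l, (G.gkkGame l).delta = ⊤ := by
    by_contra! hcon
    -- A run of `nN + 1` steps would have `D ≥ nN + 1`, against `D ≤ nN`.
    have h := MPGame.isRun_totalPotential hG (l := Fintype.card V * G.maxWeight + 1) fun j _ => hcon j
    have h1 := h.le_sum le_rfl
    have h2 := h.sum_le hG
    push_cast at h1
    omega
  classical
  obtain ⟨l, hl, hmin⟩ : ∃ l, (G.gkkGame l).delta = ⊤ ∧ ∀ j < l, (G.gkkGame j).delta ≠ ⊤ :=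
    ⟨Nat.find hfinite, Nat.find_spec hfinite, fun j hj => Nat.find_min hfinite hj⟩
  have h := MPGame.isRun_totalPotential hG hmin
  have ht : (G.reduce (G.totalPotential l)).IsDelta ⊤ := hl ▸ MPGame.isDelta_gkkGame hG l
  refine ⟨⟨l + 1, ⟨l, rfl, hmin, hl⟩, ?_⟩, ?_⟩
  · have h1 : (l : ℝ) ≤ _ := (Int.cast_le (R := ℝ)).2 (h.le_sum le_rfl)
    have h2 := h.sum_le_maxWeight_add hG ht
    push_cast at h1 h2 ⊢
    linarith
  · have := h.add_le_card_mul hG ht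
    linarith
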